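/- Identify the plane with $\mathbb C$, let $\lambda=1+\sqrt2$ and $u_k=e^{\pi i k/4}$ for $k\in\mathbb Z/8$. The tiles are the translates of the following $20$ prototiles: - the rhombi $R_k$, $k=0,1,2,3$, with vertices $0,\ u_k,\ u_k+u_{k+1},\ u_{k+1}$; for $k=4,\dots,7$ let $R_k=R_{k-4}+u_k+u_{k+1}$ (the same description of the vertices holds); - the isosceles right triangles $L_k$ (vertices $0,\ \sqrt2\,u_k,\ u_{k+1}$) and $M_k$ (vertices $0,\ \sqrt2\,u_k,\ u_{k-1}$), $k\in\mathbb Z/8$, whose hypotenuse carries an arrow from $0$ to $\sqrt2\,u_k$; the right angle lies to the left of the arrow for $L_k$ and to the right for $M_k$. The Ammann–Beenker inflation rule magnifies a tile by $\lambda$ about the origin and dissects it; a tile $P+x$ is replaced by the tiles below, each translated by $\lambda x$: - $R_k\ (0\le k\le 3)\mapsto R_k,\ R_{k+2}+\lambda u_k,\ R_k+\sqrt2(u_k+u_{k+1}),\ L_k+u_k,\ M_{k+1}+u_{k+1},\ L_{k+4}+\sqrt2u_k+\lambda u_{k+1},\ M_{k+5}+\lambda u_k+\sqrt2u_{k+1}$;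 - $L_k\mapsto L_{k+5}+\sqrt2u_{k+1},\ M_{k+4}+\lambda u_k,\ L_{k+3}+2u_k+u_{k+1},\ R_{k+1}+u_k,\ R_{k-1}+u_k+u_{k+1}$; - $M_k\mapsto M_{k-5}+\sqrt2u_{k-1},\ L_{k-4}+\lambda u_k,\ M_{k-3}+2u_k+u_{k-1},\ R_{k-2}+u_k,\ R_{k}+u_k+u_{k-1}$. A level-$n$ supertile is the set of tiles obtained from a single tile by applying the rule $n$ times. An Ammann–Beenker tiling is a set $T$ of tiles that cover the plane, have pairwise disjoint interiors, and such that every finite subset of $T$ is contained in some supertile. **Theorem.** Let $T$ be an Ammann–Beenker tiling, and call two distinct tiles of $T$ adjacent if they have a nondegenerate line segment in common. The smallest number of colours needed to colour the tiles (faces) of $T$ so that adjacent tiles receive different colours is $2$. Moreover, a proper $2$-colouring is obtained by colouring each tile according to its orientation: translates of $R_0,R_2$ are blue and translates of $R_1,R_3$ are red; translates of $L_k$ are red for even $k$ and blue for odd $k$; translates of $M_k$ are blue for even $k$ and red for odd $k$. -/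

import Mathlib

namespace AmmannBeenker

/-- The primitive eighth root of unity `exp (π i / 4)`; the plane is identified with `ℂ`. -/
noncomputable def zeta : ℂ := ⟨√2 / 2, √2 / 2⟩

/-- The unit vector of direction `k · 45°`. -/
noncomputable def dir (k : ZMod 8) : ℂ := zeta ^ k.val

/-- `√2` and the inflation factor `1 + √2`, as complex numbers. -/
noncomputable def rtTwo : ℂ := ((√2 : ℝ) : ℂ)

noncomputable def lam : ℂ := ((1 + √2 : ℝ) : ℂ)

/-- The 20 orientations of the prototiles: 4 for the (undecorated) rhombus, and 16 for the right
triangle whose hypotenuse carries an arrow.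
* `rhombus k` has sides in the directions `k · 45°` and `(k + 1) · 45°`, for `k = 0, 1, 2, 3`;
* `triangleLeft k`, `triangleRight k` have an arrow pointing in direction `k · 45°`, and their
  right angle lies on the left, respectively on the right, of the arrow. -/
inductive Orientation where
  | rhombus (k : ZMod 4)
  | triangleLeft (k : ZMod 8)
  | triangleRight (k : ZMod 8)

/-- A tile: an orientation and the position of a base point. The base point of a triangle is the
tail of its arrow; that of `rhombus k` is the vertex from which the sides issue in the
directions `k · 45°` and `(k + 1) · 45°`, where `k = 0, 1, 2, 3`. -/
@[ext]
structure Tile where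
  orientation : Orientation
  pos : ℂ

/-- The vertices of a prototile with base point `0`: rhombus of side `1` and angle `45°`, and
isosceles right triangle of sides `1, 1, √2`. -/
noncomputable def Orientation.vertices : Orientation → Set ℂ
  | .rhombus k =>
      {0, dir (k.val : ZMod 8), dir (k.val : ZMod 8) + dir ((k.val : ZMod 8) + 1),
        dir ((k.val : ZMod 8) + 1)}
  | .triangleLeft k => {0, rtTwo * dir k, dir (k + 1)}
  | .triangleRight k => {0, rtTwo * dir k, dir (k - 1)}

/-- The closed polygon covered by a tile. -/
noncomputable def Tile.region (t : Tile) : Set ℂ :=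
  (fun z => t.pos + z) '' convexHull ℝ t.orientation.vertices

/-- The rhombus with a vertex `x` and sides from `x` in the directions `k · 45°`, `(k + 1) · 45°`,
for every `k` modulo 8. For `k = 4, 5, 6, 7` it is recorded through the vertex opposite
to `x`, so that each rhombus in the plane is represented by exactly one `Tile`. -/
noncomputable def rhombusAt (k : ZMod 8) (x : ℂ) : Tile :=
  ⟨.rhombus (k.val : ZMod 4), if k.val < 4 then x else x + dir k + dir (k + 1)⟩

/-- The triangle with an arrow from `x` to `x + √2 · dir k` and its right angle on the left. -/
def leftAt (k : ZMod 8) (x : ℂ) : Tile := ⟨.triangleLeft k, x⟩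

/-- The triangle with an arrow from `x` to `x + √2 · dir k` and its right angle on the right. -/
def rightAt (k : ZMod 8) (x : ℂ) : Tile := ⟨.triangleRight k, x⟩

/-- The inflation rule: the tile is magnified by `1 + √2` about the origin and dissected, a
rhombus into three rhombi and four triangles, a triangle into two rhombi and three triangles.
The rule for the right-handed triangle is the mirror image of that for the left-handed one. -/
noncomputable def Tile.inflate : Tile → Set Tile
  | ⟨.rhombus j, x⟩ =>
      let k : ZMod 8 := (j.val : ZMod 8)
      let y := lam * x
      {rhombusAt k y,
       rhombusAt (k + 2) (y + lam * dir k),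
       rhombusAt k (y + rtTwo * dir k + rtTwo * dir (k + 1)),
       leftAt k (y + dir k),
       rightAt (k + 1) (y + dir (k + 1)),
       leftAt (k + 4) (y + rtTwo * dir k + lam * dir (k + 1)),
       rightAt (k + 5) (y + lam * dir k + rtTwo * dir (k + 1))}
  | ⟨.triangleLeft k, x⟩ =>
      let y := lam * x
      {leftAt (k + 5) (y + rtTwo * dir (k + 1)),
       rightAt (k + 4) (y + lam * dir k),
       leftAt (k + 3) (y + 2 * dir k + dir (k + 1)),
       rhombusAt (k + 1) (y + dir k),
       rhombusAt (k - 1) (y + dir k + dir (k + 1))}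
  | ⟨.triangleRight k, x⟩ =>
      let y := lam * x
      {rightAt (k - 5) (y + rtTwo * dir (k - 1)),
       leftAt (k - 4) (y + lam * dir k),
       rightAt (k - 3) (y + 2 * dir k + dir (k - 1)),
       rhombusAt (k - 2) (y + dir k),
       rhombusAt k (y + dir k + dir (k - 1))}

/-- The inflation rule applied to every tile of a patch. -/
noncomputable def inflatePatch (P : Set Tile) : Set Tile := ⋃ t ∈ P, t.inflate

/-- The level-`n` supertile of a tile: the patch obtained by applying the rule `n` times. -/
noncomputable def supertile (n : ℕ) (t : Tile) : Set Tile := inflatePatch^[n] {t}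

/-- An Ammann–Beenker tiling: a tiling of the plane, every finite patch of which occurs in some
supertile. The seed `t` may have any position, so supertiles are taken up to translation. -/
structure IsAmmannBeenkerTiling (T : Set Tile) : Prop where
  covers : ⋃ t ∈ T, t.region = Set.univ
  nonoverlapping : T.Pairwise fun s t => Disjoint (interior s.region) (interior t.region)
  legal : ∀ P : Set Tile, P ⊆ T → P.Finite → ∃ (n : ℕ) (t : Tile), P ⊆ supertile n t

/-- The adjacency graph of the faces (tiles): two distinct tiles are adjacent when their
boundaries share more than isolated points, i.e. when a nondegenerate line segment lies in both. -/
def faceGraph (T : Set Tile) : SimpleGraph T where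
  Adj s t := s ≠ t ∧ ∃ a b : ℂ, a ≠ b ∧
    segment ℝ a b ⊆ Tile.region s ∧ segment ℝ a b ⊆ Tile.region t
  symm := ⟨fun _ _ ⟨h, a, b, hab, hs, ht⟩ => ⟨h.symm, a, b, hab, ht, hs⟩⟩
  loopless := ⟨fun _ h => h.1 rfl⟩

abbrev red : Fin 2 := 0

abbrev blue : Fin 2 := 1

/-- The colour of a prototile, read off from its orientation. -/
def Orientation.colour : Orientation → Fin 2
  | .rhombus k => if Even k.val then blue else red
  | .triangleLeft k => if Even k.val then red else blue
  | .triangleRight k => if Even k.val then blue else red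

end AmmannBeenker

/-! Orient every side of every prototile, the rhombi included, as an arrow of length `1` or `√2`.
The colour of a tile can be read off from any one of its sides: it depends only on the parity of the
heading, the length, and the side of the arrow on which the tile lies, and it flips with the last of
these (`colour_eq_sideColour`, `sideColour_not`). Tiles on the two sides of a common arrow therefore
differ in colour.

It remains to see that two tiles with a segment in common share a whole arrow. Call two tiles
compatible if they share an arrow from opposite sides or have at most one common point. Distinct
tiles of a supertile are compatible, by induction on the level. Parts of one inflated tile are
handled by a finite check (`parts_pairwise`). For parts of two tiles that share an arrow, the
inflated arrow is subdivided in a way that depends only on its heading and length, so the two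
subdivisions match (`parts_meetsSide`, `Compatible.inflate`). For tiles that meet in at most one
point, it suffices that the parts stay inside the inflated tiles. Legality carries this over to any
two tiles of `T`.

The finite checks are decided with integer coordinates in `ℤ[ζ]`, where polygons are compared
through signs of cross products in `ℤ[√2]`.

One colour is not enough because adjacent tiles exist (`exists_adj`): a side of a tile is covered by
finitely many other tiles, so one of them contains two of its points and, by convexity, a segment.
-/

namespace AmmannBeenker

/-! ### The integral model `ℤ[ζ] = ℤ⁴` -/

/-- `(a, b, c, d)` stands for `a + b ζ + c ζ² + d ζ³`. -/
abbrev LatticePoint := ℤ × ℤ × ℤ × ℤ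

namespace LatticePoint

/-- The power `ζ ^ k`. -/
def unit (k : ZMod 8) : LatticePoint :=
  [(1, 0, 0, 0), (0, 1, 0, 0), (0, 0, 1, 0), (0, 0, 0, 1),
    (-1, 0, 0, 0), (0, -1, 0, 0), (0, 0, -1, 0), (0, 0, 0, -1)].getD k.val 0

/-- Multiplication by `√2 = ζ - ζ³`. -/
def mulSqrt (v : LatticePoint) : LatticePoint :=
  (v.2.1 - v.2.2.2, v.1 + v.2.2.1, v.2.1 + v.2.2.2, v.2.2.1 - v.1)

/-- Multiplication by `1 + √2`. -/
def mulLam (v : LatticePoint) : LatticePoint := v + mulSqrt v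

/-- Multiplication by `√2 - 1`, the inverse of `1 + √2`. -/
def divLam (v : LatticePoint) : LatticePoint := mulSqrt v - v

/-- Twice the cross product of two vectors, as an element of `ℤ[√2]`. -/
def cross (w z : LatticePoint) : ℤ × ℤ :=
  (2 * (w.1 * z.2.2.1 - w.2.2.1 * z.1 + (w.2.1 * z.2.2.2 - w.2.2.2 * z.2.1)),
    w.1 * z.2.1 - w.2.1 * z.1 + (w.2.1 * z.2.2.1 - w.2.2.1 * z.2.1)
      + (w.2.2.1 * z.2.2.2 - w.2.2.2 * z.2.2.1) + (w.1 * z.2.2.2 - w.2.2.2 * z.1))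

end LatticePoint

/-- Positivity of `p.1 + p.2 √2`. -/
abbrev SqrtPos (p : ℤ × ℤ) : Prop :=
  (0 < p.1 ∧ 0 ≤ p.2) ∨ (0 ≤ p.1 ∧ 0 < p.2) ∨ (0 < p.1 ∧ 2 * p.2 ^ 2 < p.1 ^ 2) ∨
    (0 < p.2 ∧ p.1 ^ 2 < 2 * p.2 ^ 2)

/-- Nonnegativity of `p.1 + p.2 √2`. -/
abbrev SqrtNonneg (p : ℤ × ℤ) : Prop := p = 0 ∨ SqrtPos p

instance (p : ℤ × ℤ) : Decidable (SqrtNonneg p) := instDecidableOr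

open LatticePoint

/-- No point of `l` is to the right of the line through `c` in direction `w`, and all but `a` and
`b` are strictly to its left. -/
abbrev IsFace (w c : LatticePoint) (l : List LatticePoint) (a b : LatticePoint) : Prop :=
  (SqrtNonneg (cross w (a - c)) ∧ SqrtNonneg (cross w (b - c))) ∧
    ∀ v ∈ l, v = a ∨ v = b ∨ SqrtPos (cross w (v - c))

instance (w c : LatticePoint) (l : List LatticePoint) (a b : LatticePoint) :
    Decidable (IsFace w c l a b) := instDecidableAnd

/-- Directions of the lines used to separate polygons. -/
def separators : List LatticePoint :=
  [0, 1, 2, 3, 4, 5, 6, 7].flatMap fun k : ZMod 8 =>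
    [unit k, unit k + unit (k + 1)]

/-- The hulls of `l` and `m` are separated by a line that meets the first at most in a vertex. -/
abbrev Separated (l m : List LatticePoint) : Prop :=
  ∃ w ∈ separators, ∃ a ∈ l, IsFace w a l a a ∧ ∀ b ∈ m, SqrtNonneg (cross w (a - b))

instance (l m : List LatticePoint) : Decidable (Separated l m) := List.decidableBEx _ _

/-- The vertices of a prototile. -/
def Orientation.corners : Orientation → List LatticePoint
  | .rhombus k => [0, unit k.val, unit k.val + unit (k.val + 1), unit (k.val + 1)]
  | .triangleLeft k => [0, mulSqrt (unit k), unit (k + 1)]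
  | .triangleRight k => [0, mulSqrt (unit k), unit (k - 1)]

/-- An oriented segment of direction `heading` and length `√2` or `1`. -/
structure Arrow where
  start : LatticePoint
  heading : ZMod 8
  long : Bool

/-- The vector from the tail to the tip of an arrow. -/
def Arrow.vec (a : Arrow) : LatticePoint :=
  if a.long then mulSqrt (unit a.heading) else unit a.heading

/-- The arrows on the sides of a prototile; the flag says whether the tile is on the left. -/
def Orientation.sides : Orientation → List (Arrow × Bool)
  | .rhombus j =>
      let k : ZMod 8 := j.val
      [(⟨0, k, false⟩, true), (⟨0, k + 1, false⟩, false),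
        (⟨unit k + unit (k + 1), k + 4, false⟩, true),
        (⟨unit k + unit (k + 1), k + 5, false⟩, false)]
  | .triangleLeft k =>
      [(⟨0, k, true⟩, true), (⟨unit (k + 1), k + 5, false⟩, true),
        (⟨mulSqrt (unit k), k + 3, false⟩, true)]
  | .triangleRight k =>
      [(⟨0, k, true⟩, false), (⟨unit (k - 1), k - 5, false⟩, false),
        (⟨mulSqrt (unit k), k - 3, false⟩, false)]

/-- The arrows into which the inflation divides an arrow with tail `0`; the flag says whether
the direction is reversed. -/
def subArrows (d : ZMod 8) (long : Bool) : List (Arrow × Bool) :=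
  if long then
    [(⟨0, d, false⟩, false), (⟨mulLam (unit d), d + 4, true⟩, true),
      (⟨mulLam (unit d) + unit d, d + 4, false⟩, true)]
  else [(⟨0, d, false⟩, false), (⟨unit d, d, true⟩, false)]

/-- The direction, parallel to an arrow, that has the given side of the arrow on its left. -/
def sideDir (d : ZMod 8) (left : Bool) : LatticePoint := if left then unit d else unit (d + 4)

/-- The colour of a tile on the given side of an arrow. -/
def sideColour (d : ZMod 8) (long left : Bool) : Fin 2 :=
  if xor (decide (Even d.val)) (xor long left) then red else blue

/-- The rhombus `rhombusAt k v`. -/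
def rhombusPlaced (k : ZMod 8) (v : LatticePoint) : Orientation × LatticePoint :=
  (.rhombus (k.val : ZMod 4), if k.val < 4 then v else v + unit k + unit (k + 1))

/-- The dissection of the inflated prototile. -/
def Orientation.parts : Orientation → List (Orientation × LatticePoint)
  | .rhombus j =>
      let k : ZMod 8 := (j.val : ZMod 8)
      [rhombusPlaced k 0,
       rhombusPlaced (k + 2) (mulLam (unit k)),
       rhombusPlaced k (mulSqrt (unit k) + mulSqrt (unit (k + 1))),
       (.triangleLeft k, unit k),
       (.triangleRight (k + 1), unit (k + 1)),
       (.triangleLeft (k + 4), mulSqrt (unit k) + mulLam (unit (k + 1))),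
       (.triangleRight (k + 5), mulLam (unit k) + mulSqrt (unit (k + 1)))]
  | .triangleLeft k =>
      [(.triangleLeft (k + 5), mulSqrt (unit (k + 1))),
       (.triangleRight (k + 4), mulLam (unit k)),
       (.triangleLeft (k + 3), unit k + unit k + unit (k + 1)),
       rhombusPlaced (k + 1) (unit k),
       rhombusPlaced (k - 1) (unit k + unit (k + 1))]
  | .triangleRight k =>
      [(.triangleRight (k - 5), mulSqrt (unit (k - 1))),
       (.triangleLeft (k - 4), mulLam (unit k)),
       (.triangleRight (k - 3), unit k + unit k + unit (k - 1)),
       rhombusPlaced (k - 2) (unit k),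
       rhombusPlaced k (unit k + unit (k - 1))]

/-! ### Verifications in the integral model -/

/-- Two placed prototiles lie on the two sides of a common arrow. -/
abbrev SharesArrow (s t : Orientation × LatticePoint) : Prop :=
  ∃ a ∈ s.1.sides, ∃ b ∈ t.1.sides, s.2 + a.1.start = t.2 + b.1.start ∧
    a.1.heading = b.1.heading ∧ a.1.long = b.1.long ∧ a.2 = !b.2

instance (s t : Orientation × LatticePoint) : Decidable (SharesArrow s t) :=
  List.decidableBEx _ _

/-- The vertices of a placed prototile. -/
abbrev placedCorners (s : Orientation × LatticePoint) : List LatticePoint := s.1.corners.map (s.2 + ·)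

/-- The part `s` of an inflated prototile with side `e` either has a side that is one of the
arrows into which `e` is divided, or meets the line through `e` at most in a vertex. -/
abbrev MeetsSide (e : Arrow × Bool) (s : Orientation × LatticePoint) : Prop :=
  (∃ i ∈ subArrows e.1.heading e.1.long, ∃ a ∈ s.1.sides,
    s.2 + a.1.start = mulLam e.1.start + i.1.start ∧ a.1.heading = i.1.heading ∧
      a.1.long = i.1.long ∧ a.2 = xor e.2 i.2) ∨
  ∃ a ∈ placedCorners s, IsFace (sideDir e.1.heading e.2) (mulLam e.1.start) (placedCorners s) a a

instance (e : Arrow × Bool) (s : Orientation × LatticePoint) : Decidable (MeetsSide e s) :=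
  instDecidableOr

/-- Leaves quantifiers over `ZMod 4` and `ZMod 8` only, which `decide` can enumerate. -/
theorem Orientation.forall_of_zmod {p : Orientation → Prop} (h₁ : ∀ k, p (.rhombus k))
    (h₂ : ∀ k, p (.triangleLeft k)) (h₃ : ∀ k, p (.triangleRight k)) (o : Orientation) : p o := by
  cases o
  exacts [h₁ _, h₂ _, h₃ _]

theorem parts_pairwise (o : Orientation) :
    o.parts.Pairwise fun s t => SharesArrow s t ∨ Separated (placedCorners s) (placedCorners t) := by
  revert o
  apply Orientation.forall_of_zmod <;> decide +kernel

theorem parts_meetsSide (o : Orientation) :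
    ∀ e ∈ o.sides, ∀ s ∈ o.parts, MeetsSide e s := by
  revert o
  apply Orientation.forall_of_zmod <;> decide +kernel

theorem sides_isFace (o : Orientation) :
    ∀ e ∈ o.sides, IsFace (sideDir e.1.heading e.2) e.1.start o.corners e.1.start
      (e.1.start + e.1.vec) := by
  revert o
  apply Orientation.forall_of_zmod <;> decide +kernel

/-- The heart of the colouring: all sides of a prototile predict the same colour. -/
theorem colour_eq_sideColour (o : Orientation) :
    ∀ e ∈ o.sides, o.colour = sideColour e.1.heading e.1.long e.2 := by
  revert o
  apply Orientation.forall_of_zmod <;> decide +kernel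

theorem sideColour_not (d : ZMod 8) (long left : Bool) :
    sideColour d long (!left) ≠ sideColour d long left := by
  revert d long left
  decide +kernel

/-- Each sub-arrow lies on the line of the arrow, and reversing it exchanges left and right, whence
the `xor`. -/
theorem subArrows_sideDir (d : ZMod 8) (long left : Bool) :
    ∀ i ∈ subArrows d long, sideDir i.1.heading (xor left i.2) = sideDir d left ∧
      cross (sideDir d left) i.1.start = 0 := by
  revert d long left
  decide +kernel

theorem subArrows_pairwise (d : ZMod 8) (long : Bool) :
    (subArrows d long).Pairwise fun i j =>
      Separated [i.1.start, i.1.start + i.1.vec] [j.1.start, j.1.start + j.1.vec] := by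
  revert d long
  decide +kernel

theorem sideDir_not (d : ZMod 8) (left : Bool) : sideDir d (!left) = -sideDir d left := by
  revert d left
  decide +kernel

/-- The vectors of the two sides of a prototile that issue from its base point, the first being
on the right, and whether the prototile is the parallelogram that they span. -/
def Orientation.frame : Orientation → LatticePoint × LatticePoint × Bool
  | .rhombus k => (unit k.val, unit (k.val + 1), true)
  | .triangleLeft k => (mulSqrt (unit k), unit (k + 1), false)
  | .triangleRight k => (unit (k - 1), mulSqrt (unit k), false)

/-- The inequalities that describe a prototile in terms of its frame. -/
abbrev InFrame (A B : LatticePoint) (rhombic : Bool) (v : LatticePoint) : Prop :=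
  SqrtNonneg (cross v B) ∧ SqrtNonneg (cross A v) ∧
    if rhombic then SqrtNonneg (cross A B - cross v B) ∧ SqrtNonneg (cross A B - cross A v)
    else SqrtNonneg (cross A B - cross v B - cross A v)

instance (A B : LatticePoint) (rhombic : Bool) (v : LatticePoint) :
    Decidable (InFrame A B rhombic v) := instDecidableAnd

theorem frame_corners (o : Orientation) :
    0 ∈ o.corners ∧ o.frame.1 ∈ o.corners ∧ o.frame.2.1 ∈ o.corners ∧
      (o.frame.2.2 = true → o.frame.1 + o.frame.2.1 ∈ o.corners) := by
  revert o
  apply Orientation.forall_of_zmod <;> decide +kernel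

theorem frame_pos (o : Orientation) : SqrtPos (cross o.frame.1 o.frame.2.1) := by
  revert o
  apply Orientation.forall_of_zmod <;> decide +kernel

theorem frame_left (o : Orientation) :
    ∀ v ∈ o.corners, SqrtNonneg (cross o.frame.1 v) := by
  revert o
  apply Orientation.forall_of_zmod <;> decide +kernel

/-- Scaled back by `divLam`, the parts stay inside the prototile; only their vertices need checking,
by convexity. -/
theorem parts_inFrame (o : Orientation) :
    ∀ s ∈ o.parts, ∀ v ∈ placedCorners s, InFrame o.frame.1 o.frame.2.1 o.frame.2.2 (divLam v) := by
  revert o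
  apply Orientation.forall_of_zmod <;> decide +kernel

/-! ### The model as a subset of the plane -/

theorem zeta_sq : zeta ^ 2 = Complex.I := by
  have h : √2 * √2 = (2 : ℝ) := Real.mul_self_sqrt (by norm_num)
  apply Complex.ext <;> simp [zeta, sq]
  linarith

theorem zeta_cube : zeta ^ 3 = ⟨-(√2 / 2), √2 / 2⟩ := by
  rw [pow_succ, zeta_sq]
  apply Complex.ext <;> simp [zeta]

theorem rtTwo_eq : rtTwo = zeta - zeta ^ 3 := by
  rw [zeta_cube]
  apply Complex.ext <;> simp [zeta, rtTwo]

theorem zeta_pow_four : zeta ^ 4 = -1 := by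
  rw [show zeta ^ 4 = (zeta ^ 2) ^ 2 by ring, zeta_sq, Complex.I_sq]

/-- The complex number represented by an element of the integral model. -/
noncomputable def LatticePoint.toComplex : LatticePoint →+ ℂ :=
  AddMonoidHom.mk'
    (fun v => v.1 + v.2.1 * zeta + v.2.2.1 * zeta ^ 2 + v.2.2.2 * zeta ^ 3)
    (fun v w => by simp only [Prod.fst_add, Prod.snd_add]; push_cast; ring)

theorem toComplex_apply (v : LatticePoint) :
    toComplex v = v.1 + v.2.1 * zeta + v.2.2.1 * zeta ^ 2 + v.2.2.2 * zeta ^ 3 := rfl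

theorem toComplex_re (v : LatticePoint) :
    (toComplex v).re = v.1 + v.2.1 * (√2 / 2) - v.2.2.2 * (√2 / 2) := by
  rw [toComplex_apply, zeta_sq, zeta_cube]
  simp [zeta]
  ring

theorem toComplex_im (v : LatticePoint) :
    (toComplex v).im = v.2.1 * (√2 / 2) + v.2.2.1 + v.2.2.2 * (√2 / 2) := by
  rw [toComplex_apply, zeta_sq, zeta_cube]
  simp [zeta]

theorem toComplex_unit (k : ZMod 8) : toComplex (unit k) = dir k := by
  have h4 := zeta_pow_four
  have h5 : zeta ^ 5 = -zeta := by linear_combination zeta * h4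
  have h6 : zeta ^ 6 = -zeta ^ 2 := by linear_combination zeta ^ 2 * h4
  have h7 : zeta ^ 7 = -zeta ^ 3 := by linear_combination zeta ^ 3 * h4
  rw [toComplex_apply]
  revert k
  -- `ZMod 8` unfolds to `Fin 8`, on which `fin_cases` can act.
  change ∀ k : Fin 8, _
  intro k
  fin_cases k <;> simp [unit, dir, ZMod.val, h4, h5, h6, h7]

theorem toComplex_mulSqrt (v : LatticePoint) : toComplex (mulSqrt v) = rtTwo * toComplex v := by
  simp only [toComplex_apply, mulSqrt, rtTwo_eq]
  push_cast
  linear_combination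
    ((v.2.1 : ℂ) + (v.2.2.2 : ℂ) * (zeta ^ 2 - 1) + (v.2.2.1 : ℂ) * zeta) * zeta_pow_four

theorem lam_eq : lam = 1 + rtTwo := by simp [lam, rtTwo]

theorem rtTwo_mul_self : rtTwo * rtTwo = 2 := by
  rw [rtTwo, ← Complex.ofReal_mul, Real.mul_self_sqrt (by norm_num)]
  norm_num

theorem toComplex_mulLam (v : LatticePoint) : toComplex (mulLam v) = lam * toComplex v := by
  rw [mulLam, map_add, toComplex_mulSqrt, lam_eq]
  ring

theorem lam_mul_toComplex_divLam (v : LatticePoint) :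
    lam * toComplex (divLam v) = toComplex v := by
  rw [divLam, map_sub, toComplex_mulSqrt, lam_eq]
  linear_combination toComplex v * rtTwo_mul_self

/-- The cross product of two vectors of the plane. -/
noncomputable def crossForm (w : ℂ) : ℂ →ₗ[ℝ] ℝ :=
  w.re • Complex.imLm - w.im • Complex.reLm

theorem crossForm_apply (w z : ℂ) : crossForm w z = w.re * z.im - w.im * z.re := by
  simp [crossForm]

theorem two_mul_crossForm (w z : LatticePoint) :
    2 * crossForm (toComplex w) (toComplex z) = (cross w z).1 + (cross w z).2 * √2 := by
  have h : √2 * √2 = (2 : ℝ) := Real.mul_self_sqrt (by norm_num)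
  rw [crossForm_apply, toComplex_re, toComplex_re, toComplex_im, toComplex_im, cross]
  push_cast
  linear_combination
    ((w.2.1 * z.2.2.2 - w.2.2.2 * z.2.1 : ℝ)) * h

theorem SqrtPos.pos {p : ℤ × ℤ} (h : SqrtPos p) : 0 < (p.1 + p.2 * √2 : ℝ) := by
  have h2 : √2 * √2 = (2 : ℝ) := Real.mul_self_sqrt (by norm_num)
  have h0 : 0 < √2 := by positivity
  obtain ⟨a, b⟩ := p
  rcases h with ⟨ha, hb⟩ | ⟨ha, hb⟩ | ⟨ha, hb⟩ | ⟨ha, hb⟩ <;> dsimp only at *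
  · have : (0 : ℝ) < a := by exact_mod_cast ha
    have : (0 : ℝ) ≤ b := by exact_mod_cast hb
    positivity
  · have : (0 : ℝ) ≤ a := by exact_mod_cast ha
    have : (0 : ℝ) < b := by exact_mod_cast hb
    positivity
  · have h1 : (0 : ℝ) < a := by exact_mod_cast ha
    have h3 : (2 * b ^ 2 : ℝ) < a ^ 2 := by exact_mod_cast hb
    have : |-(b * √2)| < (a : ℝ) := abs_lt_of_sq_lt_sq (by nlinarith) h1.le
    linarith [le_abs_self (-(b * √2))]
  · have h1 : (0 : ℝ) < b := by exact_mod_cast ha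
    have h3 : (a ^ 2 : ℝ) < 2 * b ^ 2 := by exact_mod_cast hb
    have : |-(a : ℝ)| < b * √2 := abs_lt_of_sq_lt_sq (by nlinarith) (by positivity)
    linarith [le_abs_self (-(a : ℝ))]

theorem SqrtPos.crossForm_pos {w z : LatticePoint} (h : SqrtPos (cross w z)) :
    0 < crossForm (toComplex w) (toComplex z) := by
  have := h.pos
  rw [← two_mul_crossForm] at this
  linarith

theorem SqrtNonneg.nonneg {p : ℤ × ℤ} (h : SqrtNonneg p) : 0 ≤ (p.1 + p.2 * √2 : ℝ) := by
  rcases h with rfl | h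
  · simp
  · exact h.pos.le

theorem SqrtNonneg.crossForm_nonneg {w z : LatticePoint} (h : SqrtNonneg (cross w z)) :
    0 ≤ crossForm (toComplex w) (toComplex z) := by
  have := h.nonneg
  rw [← two_mul_crossForm] at this
  linarith

/-! ### Polygons and their supporting lines -/

/-- The convex polygon spanned by points of the integral model. -/
noncomputable def hull (l : List LatticePoint) : Set ℂ := convexHull ℝ (toComplex '' {v | v ∈ l})

theorem convex_hull (l : List LatticePoint) : Convex ℝ (hull l) := convex_convexHull _ _

theorem toComplex_mem_hull {l : List LatticePoint} {v : LatticePoint} (h : v ∈ l) :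
    toComplex v ∈ hull l :=
  subset_convexHull _ _ ⟨v, h, rfl⟩

theorem hull_subset {l : List LatticePoint} {S : Set ℂ} (hS : Convex ℝ S)
    (h : ∀ v ∈ l, toComplex v ∈ S) : hull l ⊆ S := by
  apply convexHull_min _ hS
  rintro _ ⟨v, hv, rfl⟩
  exact h v hv

theorem hull_map_add (v : LatticePoint) (l : List LatticePoint) :
    hull (l.map (v + ·)) = (toComplex v + ·) '' hull l := by
  apply subset_antisymm
  · refine hull_subset (by simpa using (convex_hull l).translate (toComplex v)) fun w hw => ?_
    obtain ⟨u, hu, rfl⟩ := List.mem_map.1 hw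
    exact ⟨toComplex u, toComplex_mem_hull hu, (map_add _ _ _).symm⟩
  · rw [Set.image_subset_iff]
    refine hull_subset ((convex_hull _).translate_preimage_right _) fun u hu => ?_
    rw [Set.mem_preimage, ← map_add]
    exact toComplex_mem_hull (List.mem_map_of_mem hu)

theorem hull_pair (a b : LatticePoint) :
    hull [a, b] = segment ℝ (toComplex a) (toComplex b) := by
  rw [hull, ← convexHull_pair]
  congr 1
  ext z
  simp [eq_comm]

/-- A proper convex combination of a point with `c ≤ f` and a point with `c < f` satisfies `c < f`.
-/
theorem convex_union_lt {K : Set ℂ} (hK : Convex ℝ K) (f : ℂ →ₗ[ℝ] ℝ) {c : ℝ}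
    (h : ∀ z ∈ K, c ≤ f z) : Convex ℝ (K ∪ {z | c < f z}) := by
  rw [convex_iff_forall_pos]
  have key : ∀ x y : ℂ, ∀ a b : ℝ, 0 < a → 0 < b → a + b = 1 → c ≤ f x → c < f y →
      c < f (a • x + b • y) := by
    intro x y a b ha hb hab hx hy
    rw [map_add, map_smul, map_smul, smul_eq_mul, smul_eq_mul]
    have h₁ := mul_le_mul_of_nonneg_left hx ha.le
    have h₂ := mul_lt_mul_of_pos_left hy hb
    have h₃ : a * c + b * c = c := by rw [← add_mul, hab, one_mul]
    linarith
  rintro x (hx | hx) y (hy | hy) a b ha hb hab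
  · exact .inl (hK hx hy ha.le hb.le hab)
  · exact .inr (key x y a b ha hb hab (h x hx) hy)
  · rw [add_comm]
    exact .inr (key y x b a hb ha (by linarith) (h y hy) hx)
  · exact .inr (key x y a b ha hb hab (le_of_lt hx) hy)

/-- The segment together with the open half plane is convex and contains every vertex, hence the
whole hull. -/
theorem IsFace.mem_or_lt {w c a b : LatticePoint} {l : List LatticePoint} (h : IsFace w c l a b)
    {z : ℂ} (hz : z ∈ hull l) :
    z ∈ segment ℝ (toComplex a) (toComplex b) ∨
      crossForm (toComplex w) (toComplex c) < crossForm (toComplex w) z := by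
  have hle : ∀ z ∈ segment ℝ (toComplex a) (toComplex b),
      crossForm (toComplex w) (toComplex c) ≤ crossForm (toComplex w) z := by
    have ha := h.1.1.crossForm_nonneg
    have hb := h.1.2.crossForm_nonneg
    rw [map_sub, map_sub, sub_nonneg] at ha hb
    exact fun z hz => (convex_halfSpace_ge (crossForm (toComplex w)).isLinear _).segment_subset
      ha hb hz
  refine hull_subset (convex_union_lt (convex_segment _ _) _ hle) (fun v hv => ?_) hz
  rcases h.2 v hv with rfl | rfl | h
  · exact .inl (left_mem_segment _ _ _)
  · exact .inl (right_mem_segment _ _ _)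
  · have := h.crossForm_pos
    rw [map_sub, map_sub, sub_pos] at this
    exact .inr this

theorem IsFace.le {w c a b : LatticePoint} {l : List LatticePoint} (h : IsFace w c l a b)
    {z : ℂ} (hz : z ∈ hull l) :
    crossForm (toComplex w) (toComplex c) ≤ crossForm (toComplex w) z := by
  have ha := h.1.1.crossForm_nonneg
  have hb := h.1.2.crossForm_nonneg
  rw [map_sub, map_sub, sub_nonneg] at ha hb
  rcases h.mem_or_lt hz with hz | hz
  · exact (convex_halfSpace_ge (crossForm (toComplex w)).isLinear _).segment_subset ha hb hz
  · exact hz.le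

theorem IsFace.mem_segment {w c a b : LatticePoint} {l : List LatticePoint} (h : IsFace w c l a b)
    {z : ℂ} (hz : z ∈ hull l)
    (hle : crossForm (toComplex w) z ≤ crossForm (toComplex w) (toComplex c)) :
    z ∈ segment ℝ (toComplex a) (toComplex b) :=
  (h.mem_or_lt hz).resolve_right hle.not_gt

/-- A common point must lie on the separating line, which meets the first polygon only in `a`. -/
theorem Separated.subsingleton {l m : List LatticePoint} (h : Separated l m) :
    (hull l ∩ hull m).Subsingleton := by
  obtain ⟨w, -, a, -, hface, hm⟩ := h
  have key : ∀ z ∈ hull l ∩ hull m, z = toComplex a := by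
    rintro z ⟨hl, hz⟩
    have hle : crossForm (toComplex w) z ≤ crossForm (toComplex w) (toComplex a) := by
      refine hull_subset (convex_halfSpace_le (crossForm (toComplex w)).isLinear _)
        (fun b hb => ?_) hz
      have := (hm b hb).crossForm_nonneg
      rw [map_sub, map_sub, sub_nonneg] at this
      exact this
    simpa using hface.mem_segment hl hle
  exact fun x hx y hy => (key x hx).trans (key y hy).symm

/-! ### Tiles -/

theorem vertices_eq (o : Orientation) : o.vertices = toComplex '' {v | v ∈ o.corners} := by
  cases o <;>
    · ext z
      simp [Orientation.vertices, Orientation.corners, toComplex_mulSqrt, toComplex_unit,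
        eq_comm]

theorem region_eq (t : Tile) : t.region = (t.pos + ·) '' hull t.orientation.corners := by
  rw [Tile.region, vertices_eq, hull]

/-- The tile given by a prototile in the integral model with respect to the origin `b`. -/
noncomputable def place (b : ℂ) (s : Orientation × LatticePoint) : Tile := ⟨s.1, b + toComplex s.2⟩

theorem region_place (b : ℂ) (s : Orientation × LatticePoint) :
    (place b s).region = (b + ·) '' hull (placedCorners s) := by
  rw [region_eq, hull_map_add, Set.image_image]
  simp [place, add_assoc]

theorem place_rhombusPlaced (b : ℂ) (k : ZMod 8) (v : LatticePoint) :
    place b (rhombusPlaced k v) = rhombusAt k (b + toComplex v) := by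
  unfold place rhombusPlaced rhombusAt
  ext1
  · rfl
  · dsimp only
    split_ifs
    · rfl
    · simp only [map_add, toComplex_unit, add_assoc]

theorem inflate_eq (t : Tile) :
    t.inflate = {u | ∃ s ∈ t.orientation.parts, u = place (lam * t.pos) s} := by
  obtain ⟨o, x⟩ := t
  have h2 (z : ℂ) : 2 * z = z + z := two_mul z
  cases o <;>
    · ext u
      simp only [Tile.inflate, Orientation.parts, Set.mem_insert_iff, Set.mem_singleton_iff,
        Set.mem_ofPred_eq, List.mem_cons, List.not_mem_nil, or_false, exists_eq_or_imp,
        exists_eq_left, place_rhombusPlaced, map_zero, add_zero]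
      simp only [place, map_add, toComplex_mulLam, toComplex_mulSqrt, toComplex_unit, leftAt,
        rightAt, add_assoc, h2]

/-! ### Prototiles in affine coordinates -/

theorem combination_mem {K : Set ℂ} (hK : Convex ℝ K) {p₀ p₁ p₂ p₃ : ℂ} (h₀ : p₀ ∈ K)
    (h₁ : p₁ ∈ K) (h₂ : p₂ ∈ K) (h₃ : p₃ ∈ K) {a₀ a₁ a₂ a₃ : ℝ} (g₀ : 0 ≤ a₀) (g₁ : 0 ≤ a₁)
    (g₂ : 0 ≤ a₂) (g₃ : 0 ≤ a₃) (h : a₀ + a₁ + a₂ + a₃ = 1) :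
    a₀ • p₀ + a₁ • p₁ + a₂ • p₂ + a₃ • p₃ ∈ K := by
  have := hK.sum_mem (t := Finset.univ) (w := ![a₀, a₁, a₂, a₃]) (z := ![p₀, p₁, p₂, p₃])
    (fun i _ => by fin_cases i <;> assumption) (by simpa [Fin.sum_univ_four] using h)
    (fun i _ => by fin_cases i <;> assumption)
  simpa [Fin.sum_univ_four] using this

/-- By Cramer's rule the coordinates of `z` in the basis `A`, `B` are quotients of cross products;
the inequalities place them in the unit square or the standard triangle. -/
theorem mem_hull_of_frame (o : Orientation) {z A B : ℂ} (hA : A = toComplex o.frame.1)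
    (hB : B = toComplex o.frame.2.1) (h₁ : 0 ≤ crossForm z B) (h₂ : 0 ≤ crossForm A z)
    (h₃ : if o.frame.2.2 then crossForm z B ≤ crossForm A B ∧ crossForm A z ≤ crossForm A B
      else crossForm z B + crossForm A z ≤ crossForm A B) : z ∈ hull o.corners := by
  have hpos : 0 < crossForm A B := by
    rw [hA, hB]
    exact (frame_pos o).crossForm_pos
  obtain ⟨c₀, cA, cB, cAB⟩ := frame_corners o
  have m₀ := toComplex_mem_hull c₀
  have mA := toComplex_mem_hull cA
  have mB := toComplex_mem_hull cB
  rw [map_zero] at m₀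
  rw [← hA] at mA
  rw [← hB] at mB
  set α := crossForm z B / crossForm A B with hα
  set β := crossForm A z / crossForm A B with hβ
  have hz : z = α • A + β • B := by
    have e : crossForm A B • z = crossForm z B • A + crossForm A z • B := by
      simp only [crossForm_apply]
      apply Complex.ext <;> simp <;> ring
    rw [hα, hβ, div_eq_inv_mul, div_eq_inv_mul, mul_smul, mul_smul, ← smul_add, ← e,
      inv_smul_smul₀ hpos.ne']
  have hα0 : 0 ≤ α := by positivity
  have hβ0 : 0 ≤ β := by positivity
  split_ifs at h₃ with hr
  · have hα1 : α ≤ 1 := (div_le_one hpos).2 h₃.1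
    have hβ1 : β ≤ 1 := (div_le_one hpos).2 h₃.2
    have mAB := toComplex_mem_hull (cAB hr)
    rw [map_add, ← hA, ← hB] at mAB
    -- Bilinear weights on the four corners of the parallelogram.
    have := combination_mem (convex_hull o.corners) m₀ mA mB mAB
      (mul_nonneg (sub_nonneg.2 hα1) (sub_nonneg.2 hβ1)) (mul_nonneg hα0 (sub_nonneg.2 hβ1))
      (mul_nonneg (sub_nonneg.2 hα1) hβ0) (mul_nonneg hα0 hβ0) (by ring)
    convert this using 1
    rw [hz]
    module
  · have hαβ : α + β ≤ 1 := by rwa [hα, hβ, ← add_div, div_le_one hpos]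
    -- The fourth point is a dummy of weight `0`.
    have := combination_mem (convex_hull o.corners) m₀ mA mB m₀
      (sub_nonneg.2 hαβ) hα0 hβ0 le_rfl (by ring)
    convert this using 1
    rw [hz]
    simp

theorem crossForm_le_of_sub_nonneg {u v w z : LatticePoint}
    (h : SqrtNonneg (cross u v - cross w z)) :
    crossForm (toComplex w) (toComplex z) ≤ crossForm (toComplex u) (toComplex v) := by
  have := h.nonneg
  have h₁ := two_mul_crossForm u v
  have h₂ := two_mul_crossForm w z
  rw [Prod.fst_sub, Prod.snd_sub] at this
  push_cast at this
  linarith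

theorem InFrame.mem_hull {o : Orientation} {v : LatticePoint}
    (h : InFrame o.frame.1 o.frame.2.1 o.frame.2.2 v) : toComplex v ∈ hull o.corners := by
  obtain ⟨h₁, h₂, h₃⟩ := h
  refine mem_hull_of_frame o rfl rfl h₁.crossForm_nonneg h₂.crossForm_nonneg ?_
  split_ifs at h₃ ⊢
  · exact ⟨crossForm_le_of_sub_nonneg h₃.1, crossForm_le_of_sub_nonneg h₃.2⟩
  · have := h₃.nonneg
    have e₁ := two_mul_crossForm o.frame.1 o.frame.2.1
    have e₂ := two_mul_crossForm v o.frame.2.1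
    have e₃ := two_mul_crossForm o.frame.1 v
    simp only [Prod.fst_sub, Prod.snd_sub] at this
    push_cast at this
    linarith

theorem region_subset_of_mem_parts (t : Tile) {s : Orientation × LatticePoint}
    (hs : s ∈ t.orientation.parts) :
    (place (lam * t.pos) s).region ⊆ (lam * ·) '' t.region := by
  rw [region_place, region_eq]
  have key : hull (placedCorners s) ⊆ (lam * ·) '' hull t.orientation.corners := by
    refine hull_subset ?_ fun v hv => ?_
    · exact (convex_hull _).is_linear_image (IsLinearMap.mk (mul_add lam) (fun c x => by
        simp only [Complex.real_smul]; ring))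
    · exact ⟨_, (parts_inFrame _ s hs v hv).mem_hull, lam_mul_toComplex_divLam v⟩
  rintro _ ⟨z, hz, rfl⟩
  obtain ⟨y, hy, rfl⟩ := key hz
  exact ⟨_, ⟨y, hy, rfl⟩, mul_add _ _ _⟩

/-! ### Supertiles -/

/-- Two tiles lie on the two sides of a common arrow. -/
def Abut (s t : Tile) : Prop :=
  ∃ a ∈ s.orientation.sides, ∃ b ∈ t.orientation.sides,
    s.pos + toComplex a.1.start = t.pos + toComplex b.1.start ∧
    a.1.heading = b.1.heading ∧ a.1.long = b.1.long ∧ a.2 = !b.2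

/-- Two tiles lie on the two sides of a common arrow, or have at most one point in common. -/
def Compatible (s t : Tile) : Prop := Abut s t ∨ (s.region ∩ t.region).Subsingleton

theorem Compatible.symm {s t : Tile} (h : Compatible s t) : Compatible t s := by
  rcases h with ⟨a, ha, b, hb, h₁, h₂, h₃, h₄⟩ | h
  · exact .inl ⟨b, hb, a, ha, h₁.symm, h₂.symm, h₃.symm, by rw [h₄, Bool.not_not]⟩
  · exact .inr (by rwa [Set.inter_comm])

theorem compatible_of_parts (b : ℂ) {s t : Orientation × LatticePoint}
    (h : SharesArrow s t ∨ Separated (placedCorners s) (placedCorners t)) :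
    Compatible (place b s) (place b t) := by
  rcases h with ⟨p, hp, q, hq, h₁, h₂⟩ | h
  · refine .inl ⟨p, hp, q, hq, ?_, h₂⟩
    simp only [place, add_assoc, ← map_add, h₁]
  · right
    rw [region_place, region_place, ← Set.image_inter (add_right_injective b)]
    exact h.subsingleton.image _

/-- The segment covered by an arrow, with respect to the origin `b`. -/
noncomputable def Arrow.segment (b : ℂ) (a : Arrow) : Set ℂ :=
  (b + ·) '' hull [a.start, a.start + a.vec]

theorem subArrows_inter_subsingleton {d : ZMod 8} {long : Bool} {i j : Arrow × Bool}
    (hi : i ∈ subArrows d long) (hj : j ∈ subArrows d long) (hij : i ≠ j) (b : ℂ) :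
    (i.1.segment b ∩ j.1.segment b).Subsingleton := by
  have : Std.Symm fun i j : Arrow × Bool => (i.1.segment b ∩ j.1.segment b).Subsingleton :=
    ⟨fun i j h => by rwa [Set.inter_comm]⟩
  refine List.Pairwise.forall (R := fun i j : Arrow × Bool =>
    (i.1.segment b ∩ j.1.segment b).Subsingleton) ?_ hi hj hij
  · refine (subArrows_pairwise d long).imp fun {i j} h => ?_
    rw [Arrow.segment, Arrow.segment, ← Set.image_inter (add_right_injective b)]
    exact h.subsingleton.image _

/-- The half plane to the left of the line through `c` in direction `w`. -/
def leftOf (w c : ℂ) : Set ℂ := {z | crossForm w c ≤ crossForm w z}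

/-- Geometric form of `parts_meetsSide`: the part lies on the correct side of the inflated arrow and
touches its line in at most one point or within one sub-arrow that is a side of the part. -/
theorem MeetsSide.part {x : ℂ} {e : Arrow × Bool} {s : Orientation × LatticePoint}
    (h : MeetsSide e s) {c w : ℂ} (hc : lam * x + lam * toComplex e.1.start = c)
    (hw : toComplex (sideDir e.1.heading e.2) = w) :
    (place (lam * x) s).region ⊆ leftOf w c ∧
      (((place (lam * x) s).region ∩ {z | crossForm w z ≤ crossForm w c}).Subsingleton ∨
        ∃ i ∈ subArrows e.1.heading e.1.long,
          (∃ a ∈ s.1.sides, lam * x + toComplex s.2 + toComplex a.1.start = c + toComplex i.1.start ∧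
            a.1.heading = i.1.heading ∧ a.1.long = i.1.long ∧ a.2 = xor e.2 i.2) ∧
          (place (lam * x) s).region ∩ {z | crossForm w z ≤ crossForm w c} ⊆ i.1.segment c) := by
  subst hc hw
  rcases h with ⟨i, hi, a, ha, h₁, h₂, h₃, h₄⟩ | ⟨a, -, h⟩
  · have hface := sides_isFace s.1 a ha
    obtain ⟨hdir, hstart⟩ := subArrows_sideDir e.1.heading e.1.long e.2 i hi
    rw [h₂, h₄, hdir] at hface
    have h₁' : toComplex s.2 + toComplex a.1.start =
        lam * toComplex e.1.start + toComplex i.1.start := by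
      rw [← map_add, h₁, map_add, toComplex_mulLam]
    have hvec : a.1.vec = i.1.vec := by rw [Arrow.vec, Arrow.vec, h₂, h₃]
    have hzero : crossForm (toComplex (sideDir e.1.heading e.2)) (toComplex i.1.start) = 0 := by
      have := two_mul_crossForm (sideDir e.1.heading e.2) i.1.start
      rw [hstart] at this
      simpa using this
    -- The supporting line of the side `a` of the part is the line of the inflated side `e`.
    have hval : crossForm (toComplex (sideDir e.1.heading e.2)) (toComplex s.2)
        + crossForm (toComplex (sideDir e.1.heading e.2)) (toComplex a.1.start) =
        crossForm (toComplex (sideDir e.1.heading e.2)) (lam * toComplex e.1.start) := by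
      rw [← map_add, h₁', map_add, hzero, add_zero]
    refine ⟨?_, .inr ⟨i, hi, ⟨a, ha, ?_, h₂, h₃, h₄⟩, ?_⟩⟩
    · rw [region_eq]
      rintro _ ⟨z, hz, rfl⟩
      have := hface.le hz
      simp only [leftOf, place, Set.mem_ofPred_eq, map_add]
      linarith
    · rw [add_assoc, h₁', add_assoc]
    · rw [region_eq]
      rintro _ ⟨⟨z, hz, rfl⟩, hle⟩
      simp only [place, Set.mem_ofPred_eq, map_add] at hle
      have hmem := hface.mem_segment hz (by linarith)
      rw [← hull_pair, hvec] at hmem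
      rw [Arrow.segment]
      -- Both segments are translates of the one from `0` to `i.1.vec`; `h₁'` matches the
      -- translations.
      have e₁ : hull [a.1.start, a.1.start + i.1.vec] =
          (toComplex a.1.start + ·) '' hull [0, i.1.vec] := by
        rw [← hull_map_add]; simp
      have e₂ : hull [i.1.start, i.1.start + i.1.vec] =
          (toComplex i.1.start + ·) '' hull [0, i.1.vec] := by
        rw [← hull_map_add]; simp
      rw [e₁] at hmem
      obtain ⟨y, hy, rfl⟩ := hmem
      rw [e₂]
      refine ⟨_, ⟨y, hy, rfl⟩, ?_⟩
      simp only [place]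
      linear_combination -h₁'
  · rw [region_place]
    constructor
    · rintro _ ⟨z, hz, rfl⟩
      have := h.le hz
      rw [toComplex_mulLam] at this
      simp only [leftOf, Set.mem_ofPred_eq, map_add]
      linarith
    · left
      have key : ∀ z ∈ (lam * x + ·) '' hull (placedCorners s) ∩
          {z | crossForm (toComplex (sideDir e.1.heading e.2)) z ≤
            crossForm (toComplex (sideDir e.1.heading e.2))
              (lam * x + lam * toComplex e.1.start)}, z = lam * x + toComplex a := by
        rintro _ ⟨⟨z, hz, rfl⟩, hle⟩
        simp only [Set.mem_ofPred_eq, map_add] at hle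
        have hmem := h.mem_segment hz (by rw [toComplex_mulLam]; linarith)
        rw [segment_same, Set.mem_singleton_iff] at hmem
        rw [hmem]
      exact fun y hy z hz => (key y hy).trans (key z hz).symm

/-- The inductive step across two different tiles. -/
theorem Compatible.inflate {p q s t : Tile} (hpq : Compatible p q) (hs : s ∈ p.inflate)
    (ht : t ∈ q.inflate) : Compatible s t := by
  rw [inflate_eq] at hs ht
  obtain ⟨s, hs, rfl⟩ := hs
  obtain ⟨t, ht, rfl⟩ := ht
  rcases hpq with ⟨a, ha, b, hb, hpos, hhead, hlong, hside⟩ | hpq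
  · obtain ⟨hs₁, hs₂⟩ := (parts_meetsSide _ a ha s hs).part (x := p.pos) rfl rfl
    obtain ⟨ht₁, ht₂⟩ := (parts_meetsSide _ b hb t ht).part (x := q.pos) rfl rfl
    have hc : lam * q.pos + lam * toComplex b.1.start =
        lam * p.pos + lam * toComplex a.1.start := by
      linear_combination -lam * hpos
    -- The two tiles lie on opposite sides of the arrow, so their half planes are opposite.
    have hw : toComplex (sideDir b.1.heading b.2) = -toComplex (sideDir a.1.heading a.2) := by
      rw [← map_neg, ← sideDir_not, hside, Bool.not_not, hhead]
    rw [hc, hw] at ht₁ ht₂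
    set c := lam * p.pos + lam * toComplex a.1.start
    set w := toComplex (sideDir a.1.heading a.2)
    have hneg : ∀ z, crossForm (-w) z = -crossForm w z := fun z => by
      simp only [crossForm_apply, Complex.neg_re, Complex.neg_im]; ring
    simp only [leftOf, hneg, neg_le_neg_iff] at ht₁ ht₂
    have hline : ∀ z ∈ (place (lam * p.pos) s).region ∩ (place (lam * q.pos) t).region,
        crossForm w z = crossForm w c := fun z hz => le_antisymm (ht₁ hz.2) (hs₁ hz.1)
    rcases hs₂ with hs₂ | ⟨i, hi, ⟨a', ha', i₁, i₂, i₃, i₄⟩, hsi⟩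
    · exact .inr (hs₂.anti fun z hz => ⟨hz.1, (hline z hz).le⟩)
    rcases ht₂ with ht₂ | ⟨j, hj, ⟨b', hb', j₁, j₂, j₃, j₄⟩, htj⟩
    · exact .inr (ht₂.anti fun z hz => ⟨hz.2, (hline z hz).ge⟩)
    rw [← hhead, ← hlong] at hj
    -- Both parts rest on pieces of one subdivision: equal pieces give a shared arrow, different
    -- ones meet in at most a point.
    by_cases hij : i = j
    · subst hij
      refine .inl ⟨a', ha', b', hb', ?_, i₂.trans j₂.symm, i₃.trans j₃.symm, ?_⟩
      · exact i₁.trans j₁.symm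
      · rw [i₄, j₄, hside]
        cases b.2 <;> cases i.2 <;> rfl
    · exact .inr ((subArrows_inter_subsingleton hi hj hij c).anti fun z hz =>
        ⟨hsi ⟨hz.1, (hline z hz).le⟩, htj ⟨hz.2, (hline z hz).ge⟩⟩)
  · right
    refine (hpq.image (lam * ·)).anti ?_
    have hlam : lam ≠ 0 := by
      rw [lam, Complex.ofReal_ne_zero]
      positivity
    rw [Set.image_inter (mul_right_injective₀ hlam)]
    exact Set.inter_subset_inter (region_subset_of_mem_parts p hs) (region_subset_of_mem_parts q ht)

theorem inflate_pairwise (p : Tile) : p.inflate.Pairwise Compatible := by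
  rw [inflate_eq]
  rintro _ ⟨s, hs, rfl⟩ _ ⟨t, ht, rfl⟩ hne
  have : Std.Symm fun s t => Compatible (place (lam * p.pos) s) (place (lam * p.pos) t) :=
    ⟨fun _ _ h => h.symm⟩
  exact List.Pairwise.forall
    (R := fun s t => Compatible (place (lam * p.pos) s) (place (lam * p.pos) t))
    ((parts_pairwise p.orientation).imp fun {_ _} h => compatible_of_parts _ h) hs ht
    (fun h => hne (by rw [h]))

theorem supertile_pairwise (n : ℕ) (p : Tile) : (supertile n p).Pairwise Compatible := by
  induction n with
  | zero => exact Set.pairwise_singleton _ _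
  | succ n ih =>
    rw [supertile, Function.iterate_succ_apply']
    intro s hs t ht hne
    simp only [inflatePatch, Set.mem_iUnion] at hs ht
    obtain ⟨p, hp, hs⟩ := hs
    obtain ⟨q, hq, ht⟩ := ht
    by_cases hpq : p = q
    · subst hpq
      exact inflate_pairwise p hs ht hne
    · exact (ih hp hq hpq).inflate hs ht

/-! ### The colouring is proper -/

theorem Abut.colour_ne {s t : Tile} (h : Abut s t) :
    s.orientation.colour ≠ t.orientation.colour := by
  obtain ⟨a, ha, b, hb, -, h₁, h₂, h₃⟩ := h
  rw [colour_eq_sideColour _ a ha, colour_eq_sideColour _ b hb, h₁, h₂, h₃]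
  exact sideColour_not _ _ _

theorem IsAmmannBeenkerTiling.colour_ne {T : Set Tile} (hT : IsAmmannBeenkerTiling T) {s t : T}
    (h : (faceGraph T).Adj s t) : s.val.orientation.colour ≠ t.val.orientation.colour := by
  obtain ⟨hne, a, b, hab, hs, ht⟩ := h
  obtain ⟨n, p, hp⟩ := hT.legal {s.val, t.val}
    (Set.pair_subset s.2 t.2) (Set.toFinite _)
  rcases supertile_pairwise n p (hp (.inl rfl)) (hp (.inr rfl))
    (fun h => hne (Subtype.ext h)) with h | h
  · exact h.colour_ne
  · exact absurd (h ⟨hs (left_mem_segment _ _ _), ht (left_mem_segment _ _ _)⟩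
      ⟨hs (right_mem_segment _ _ _), ht (right_mem_segment _ _ _)⟩) hab

/-! ### Existence of adjacent tiles -/

instance : Finite Orientation :=
  Finite.of_surjective
    (fun x : ZMod 4 ⊕ ZMod 8 ⊕ ZMod 8 =>
      x.elim Orientation.rhombus (Sum.elim Orientation.triangleLeft Orientation.triangleRight))
    (Orientation.forall_of_zmod (fun k => ⟨.inl k, rfl⟩) (fun k => ⟨.inr (.inl k), rfl⟩)
      (fun k => ⟨.inr (.inr k), rfl⟩))

theorem isCompact_hull (l : List LatticePoint) : IsCompact (hull l) :=
  (l.finite_toSet.image _).isCompact_convexHull ℝ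

theorem isCompact_region (t : Tile) : IsCompact t.region := by
  rw [region_eq]
  exact (isCompact_hull _).image (continuous_const.add continuous_id)

theorem convex_region (t : Tile) : Convex ℝ t.region := by
  rw [region_eq]
  simpa using (convex_hull t.orientation.corners).translate t.pos

theorem interior_hull_nonempty (o : Orientation) : (interior (hull o.corners)).Nonempty := by
  set A := toComplex o.frame.1 with hA
  set B := toComplex o.frame.2.1 with hB
  have hpos : 0 < crossForm A B := (frame_pos o).crossForm_pos
  have hopen : IsOpen {z | 0 < crossForm z B ∧ 0 < crossForm A z ∧
      crossForm z B + crossForm A z < crossForm A B} := by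
    have h₁ : Continuous fun z => crossForm z B := by
      simp only [crossForm_apply]
      fun_prop
    have h₂ : Continuous (crossForm A) := LinearMap.continuous_of_finiteDimensional _
    exact (isOpen_lt continuous_const h₁).inter
      ((isOpen_lt continuous_const h₂).inter (isOpen_lt (h₁.add h₂) continuous_const))
  refine ⟨(1 / 4 : ℝ) • (A + B), interior_maximal ?_ hopen ?_⟩
  · rintro z ⟨h₁, h₂, h₃⟩
    refine mem_hull_of_frame o hA hB h₁.le h₂.le ?_
    split_ifs
    · exact ⟨by linarith, by linarith⟩
    · exact h₃.le
  · have e₁ : crossForm ((1 / 4 : ℝ) • (A + B)) B = 1 / 4 * crossForm A B := by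
      simp only [crossForm_apply, Complex.real_smul, Complex.mul_re, Complex.mul_im,
        Complex.ofReal_re, Complex.ofReal_im, Complex.add_re, Complex.add_im]
      ring
    have e₂ : crossForm A ((1 / 4 : ℝ) • (A + B)) = 1 / 4 * crossForm A B := by
      simp only [crossForm_apply, Complex.real_smul, Complex.mul_re, Complex.mul_im,
        Complex.ofReal_re, Complex.ofReal_im, Complex.add_re, Complex.add_im]
      ring
    simp only [Set.mem_ofPred_eq, e₁, e₂]
    exact ⟨by linarith, by linarith, by linarith⟩

theorem volume_interior_region (t : Tile) :
    MeasureTheory.volume (interior t.region) =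
      MeasureTheory.volume (interior (hull t.orientation.corners)) := by
  have h := (Homeomorph.addLeft t.pos).image_interior (hull t.orientation.corners)
  rw [Homeomorph.coe_addLeft] at h
  rw [region_eq, ← h, Set.image_add_left, MeasureTheory.measure_preimage_add]

theorem IsAmmannBeenkerTiling.finite_meeting {T : Set Tile} (hT : IsAmmannBeenkerTiling T)
    (R : ℝ) : {t ∈ T | (t.region ∩ Metric.closedBall 0 R).Nonempty}.Finite := by
  have key (o : Orientation) :
      {t ∈ T | t.orientation = o ∧ (t.region ∩ Metric.closedBall 0 R).Nonempty}.Finite := by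
    set S := {t ∈ T | t.orientation = o ∧ (t.region ∩ Metric.closedBall 0 R).Nonempty}
    obtain ⟨M, hM⟩ := (isCompact_hull o.corners).isBounded.exists_norm_le
    have hball : (⋃ t : S, interior t.val.region) ⊆ Metric.closedBall 0 (R + 2 * M) := by
      refine Set.iUnion_subset fun t => interior_subset.trans ?_
      obtain ⟨t, -, ho, y, hy, hyR⟩ := t
      dsimp only
      rw [region_eq, ho] at hy ⊢
      obtain ⟨y, hy, rfl⟩ := hy
      rintro _ ⟨z, hz, rfl⟩
      rw [mem_closedBall_zero_iff] at hyR ⊢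
      dsimp only at hyR ⊢
      have h₁ := hM y hy
      have h₂ := hM z hz
      calc ‖t.pos + z‖ = ‖(t.pos + y) - y + z‖ := by ring_nf
        _ ≤ ‖t.pos + y‖ + ‖y‖ + ‖z‖ := (norm_add_le _ _).trans (by gcongr; exact norm_sub_le _ _)
        _ ≤ R + 2 * M := by linarith
    have hfin := MeasureTheory.Measure.finite_const_le_meas_of_disjoint_iUnion
      (MeasureTheory.volume : MeasureTheory.Measure ℂ)
      (isOpen_interior.measure_pos MeasureTheory.volume (interior_hull_nonempty o))
      (As := fun t : S => interior t.val.region) (fun _ => isOpen_interior.measurableSet)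
      (fun s t hst => hT.nonoverlapping s.2.1 t.2.1 fun h => hst (Subtype.ext h))
      ((MeasureTheory.measure_mono hball).trans_lt MeasureTheory.measure_closedBall_lt_top).ne
    refine Set.finite_coe_iff.1 (Set.finite_univ_iff.1 (hfin.subset fun t _ => ?_))
    have := volume_interior_region t.val
    rw [t.2.2.1] at this
    exact this.ge
  refine (Set.finite_iUnion key).subset ?_
  rintro t ⟨ht, h⟩
  exact Set.mem_iUnion.2 ⟨t.orientation, ht, rfl, h⟩

theorem IsAmmannBeenkerTiling.exists_adj {T : Set Tile} (hT : IsAmmannBeenkerTiling T) :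
    ∃ s t, (faceGraph T).Adj s t := by
  obtain ⟨s, hs, -⟩ : ∃ s ∈ T, (0 : ℂ) ∈ s.region := by
    have : (0 : ℂ) ∈ ⋃ t ∈ T, t.region := hT.covers ▸ Set.mem_univ _
    simpa using this
  set A := toComplex s.orientation.frame.1 with hA
  set B := toComplex s.orientation.frame.2.1 with hB
  have hpos : 0 < crossForm A B := (frame_pos s.orientation).crossForm_pos
  have hA0 : A ≠ 0 := by
    intro h
    simp [crossForm_apply, h] at hpos
  have hAA : crossForm A A = 0 := by rw [crossForm_apply]; ring
  have hleft : hull s.orientation.corners ⊆ {z | 0 ≤ crossForm A z} :=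
    hull_subset (convex_halfSpace_ge (crossForm A).isLinear 0)
      fun v hv => (frame_left _ v hv).crossForm_nonneg
  set side : ℝ → ℂ := fun τ => s.pos + τ • A
  set R := ‖s.pos‖ + ‖A‖ + ‖B‖
  set F := {t ∈ T | (t.region ∩ Metric.closedBall 0 R).Nonempty} \ {s}
  have hF : F.Finite := (hT.finite_meeting R).sdiff
  have hclosed : IsClosed (⋃ t ∈ F, t.region) :=
    hF.isClosed_biUnion fun t _ => (isCompact_region t).isClosed
  have hside_mem (τ : ℝ) (hτ : τ ∈ Set.Icc 0 1) : side τ ∈ s.region := by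
    rw [region_eq]
    obtain ⟨c₀, cA, -⟩ := frame_corners s.orientation
    have h₀ := toComplex_mem_hull c₀
    rw [map_zero] at h₀
    have := convex_hull _ h₀ (toComplex_mem_hull cA) (sub_nonneg.2 hτ.2) hτ.1 (by ring)
    exact ⟨τ • A, by simpa using this, rfl⟩
  have hcover (τ : ℝ) (hτ : τ ∈ Set.Icc 0 1) : ∃ t ∈ F, side τ ∈ t.region := by
    have hnear (ε : ℝ) (hε : ε ∈ Set.Ioc (0 : ℝ) 1) : side τ - ε • B ∈ ⋃ t ∈ F, t.region := by
      have hout : side τ - ε • B ∉ s.region := by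
        rw [region_eq]
        rintro ⟨z, hz, hzε⟩
        have hz' : z = τ • A - ε • B := by
          have : s.pos + z = s.pos + τ • A - ε • B := hzε
          linear_combination this
        have := hleft hz
        rw [hz', Set.mem_ofPred_eq, map_sub, map_smul, map_smul, hAA] at this
        simp only [smul_eq_mul] at this
        nlinarith [mul_pos hε.1 hpos]
      have hcov : side τ - ε • B ∈ ⋃ t ∈ T, t.region := hT.covers ▸ Set.mem_univ _
      simp only [Set.mem_iUnion, exists_prop] at hcov ⊢
      obtain ⟨t, ht, hmem⟩ := hcov
      refine ⟨t, ⟨⟨ht, _, hmem, ?_⟩, ?_⟩, hmem⟩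
      · rw [mem_closedBall_zero_iff]
        calc ‖s.pos + τ • A - ε • B‖ ≤ ‖s.pos‖ + ‖τ • A‖ + ‖ε • B‖ :=
              (norm_sub_le _ _).trans (by gcongr; exact norm_add_le _ _)
          _ ≤ ‖s.pos‖ + 1 * ‖A‖ + 1 * ‖B‖ := by
              rw [norm_smul, norm_smul, Real.norm_of_nonneg hτ.1, Real.norm_of_nonneg hε.1.le]
              gcongr
              exacts [hτ.2, hε.2]
          _ = R := by rw [one_mul, one_mul]
      · rintro rfl
        exact hout hmem
    have hlim : Filter.Tendsto (fun ε : ℝ => side τ - ε • B) (nhdsWithin 0 (Set.Ioi 0))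
        (nhds (side τ)) := by
      have : Continuous fun ε : ℝ => side τ - ε • B := by fun_prop
      simpa using (this.tendsto 0).mono_left nhdsWithin_le_nhds
    have := hclosed.mem_of_tendsto hlim
      (Filter.eventually_of_mem (Ioc_mem_nhdsGT one_pos) hnear)
    simpa only [Set.mem_iUnion, exists_prop] using this
  have : Nonempty Tile := ⟨s⟩
  choose! f hfF hf using hcover
  obtain ⟨x, hx, y, hy, hxy, hfxy⟩ :=
    (Set.Icc_infinite (zero_lt_one (α := ℝ))).exists_ne_map_eq_of_mapsTo
      (t := F) (f := f) (fun τ hτ => hfF τ hτ) hF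
  have hfy : side y ∈ (f x).region := hfxy.symm ▸ hf y hy
  refine ⟨⟨s, hs⟩, ⟨f x, (hfF x hx).1.1⟩, fun h => (hfF x hx).2 (Subtype.ext_iff.1 h).symm,
    side x, side y, fun h => hxy ?_, ?_, ?_⟩
  · exact smul_left_injective ℝ hA0 (add_left_cancel h)
  · exact (convex_region s).segment_subset (hside_mem x hx) (hside_mem y hy)
  · exact (convex_region _).segment_subset (hf x hx) hfy

end AmmannBeenker

theorem theorem4p3 (T : Set AmmannBeenker.Tile) (hT : AmmannBeenker.IsAmmannBeenkerTiling T) :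
    (AmmannBeenker.faceGraph T).chromaticNumber = 2 ∧
    ∃ C : (AmmannBeenker.faceGraph T).Coloring (Fin 2),
      ∀ t : T, C t = t.val.orientation.colour := by
  let C : (AmmannBeenker.faceGraph T).Coloring (Fin 2) :=
    SimpleGraph.Coloring.mk (fun t => t.val.orientation.colour) fun h => hT.colour_ne h
  obtain ⟨s, t, hst⟩ := hT.exists_adj
  exact ⟨le_antisymm (SimpleGraph.Colorable.chromaticNumber_le ⟨C⟩)
    (SimpleGraph.two_le_chromaticNumber_of_adj hst), C, fun _ => rfl⟩
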